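/- Let $k\ge 0$ be an integer, $d=2^k$, and let $\sigma_x,\sigma_y,\sigma_z$ be the Pauli matrices with normalised eigenvectors $\sigma_a e^a_{\pm}=\pm e^a_\pm$, and $\sigma_I=\mathbf 1$. For a setting $\mathbf s\in\{x,y,z\}^k$, an outcome $\mathbf o\in\{+1,-1\}^k$ and $\mathbf b\in\{I,x,y,z\}^k$ put $P^{\mathbf s}_{\mathbf o}=\bigotimes_j |e^{s_j}_{o_j}\rangle\langle e^{s_j}_{o_j}|$, $\sigma_{\mathbf b}=\bigotimes_j\sigma_{b_j}$, $A_{\mathbf b}(\mathbf o|\mathbf s)=\mathrm{Tr}(\sigma_{\mathbf b}P^{\mathbf s}_{\mathbf o})$ and $d(\mathbf b)=|\{j:b_j=I\}|$. For a real table $f=(f(\mathbf o|\mathbf s))_{\mathbf o,\mathbf s}$, the least squares estimator (LSE) is $$\widehat\rho^{(ls)}(f)=\sum_{\mathbf b}\theta_{\mathbf b}(f)\,\sigma_{\mathbf b},\qquad \theta_{\mathbf b}(f)=\sum_{\mathbf o}\sum_{\mathbf s} f(\mathbf o|\mathbf s)\frac{A_{\mathbf b}(\mathbf o|\mathbf s)}{2^k3^{d(\mathbf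 b)}} .$$ (1) For every real table $f$: the vector $\theta(f)$ is the unique minimiser of $\theta\mapsto\sum_{\mathbf s,\mathbf o}|f(\mathbf o|\mathbf s)-\sum_{\mathbf b}A_{\mathbf b}(\mathbf o|\mathbf s)\theta_{\mathbf b}|^2$ over $\mathbb C^{4^k}$; the matrix $\widehat\rho^{(ls)}(f)$ is Hermitian; among the Hermitian matrices $\tau$ with $\mathrm{Tr}\,\tau=1$ there is exactly one, $\widehat\rho^{(ls,n)}(f)$, which minimises $\|\tau-\widehat\rho^{(ls)}(f)\|_2^2$ (Frobenius norm); and, if $\widehat\lambda_1\ge\dots\ge\widehat\lambda_d$ are the eigenvalues of $\widehat\rho^{(ls)}(f)$ and $c=\frac1d\bigl(1-\sum_j\widehat\lambda_j\bigr)$, then the eigenvalues of $\widehat\rho^{(ls,n)}(f)$ in decreasing order are $\widehat\lambda_j+c$, with the same eigenvectors: $\widehat\rho^{(ls)}(f)v=av$ if and only if $\widehat\rho^{(ls,n)}(f)v=(a+c)v$, for all $v\in\mathbb C^d$ and $a\in\mathbb C$. (2) There is $\varepsilon_0>0$, which may depend on $k$ only, such that for all $0<\varepsilon\le\varepsilon_0$,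 all $n\ge1$ and all density matrices $\rho$ on $\mathbb C^d$ the following holds. Let $X_{\mathbf s,i}$ ($\mathbf s\in\{x,y,z\}^k$, $1\le i\le n$) be independent random outcomes with $\mathbb P_\rho(X_{\mathbf s,i}=\mathbf o)=\mathrm{Tr}(\rho P^{\mathbf s}_{\mathbf o})$, and let $\widehat\rho_n^{(ls,n)}$ be the matrix $\widehat\rho^{(ls,n)}(f)$ computed from the empirical frequencies $f(\mathbf o|\mathbf s)=\frac1n|\{i:X_{\mathbf s,i}=\mathbf o\}|$. Then, in operator norm, $$\mathbb P_\rho\bigl(\|\widehat\rho_n^{(ls,n)}-\rho\|\le 2\nu(\varepsilon)\bigr)>1-\varepsilon,\qquad \nu(\varepsilon)=\sqrt{\frac2n\Bigl(\frac23\Bigr)^k\log\frac{2^{k+1}}{\varepsilon}} .$$ -/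

import Mathlib

open scoped Matrix ComplexOrder
open MeasureTheory ProbabilityTheory

noncomputable section

namespace Tomography

/-- The three Pauli axes `x`, `y`, `z`. -/
inductive Axis
  | x
  | y
  | z
  deriving DecidableEq

instance : Fintype Axis where
  elems := {.x, .y, .z}
  complete a := by cases a <;> simp

instance : DiscreteMeasurableSpace ℤˣ where
  forall_measurableSet t := ⟨Units.val '' t, MeasurableSet.of_discrete,
    Set.preimage_image_eq t Units.val_injective⟩

/-- Measurement settings: one Pauli axis for each of the `k` qubits. -/
abbrev Setting (k : ℕ) : Type := Fin k → Axis

/-- Measurement outcomes: one sign `+1` or `-1` for each of the `k` qubits. -/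
abbrev Outcome (k : ℕ) : Type := Fin k → ℤˣ

/-- Labels in `{I, x, y, z}^k`; the value `none` stands for `I`. -/
abbrev PauliLabel (k : ℕ) : Type := Fin k → Option Axis

/-- Complex `2^k × 2^k` matrices, in the computational basis of the `k`-fold tensor power
of `ℂ²`. -/
abbrev Mat (k : ℕ) : Type := Matrix (Fin k → Fin 2) (Fin k → Fin 2) ℂ

/-- The Pauli matrices. -/
def pauli : Axis → Matrix (Fin 2) (Fin 2) ℂ
  | .x => !![0, 1; 1, 0]
  | .y => !![0, -Complex.I; Complex.I, 0]
  | .z => !![1, 0; 0, -1]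

/-- The Pauli matrices together with the identity. -/
def pauliExt : Option Axis → Matrix (Fin 2) (Fin 2) ℂ
  | none => 1
  | some a => pauli a

/-- The normalised eigenvector of the Pauli matrix `pauli a` for the eigenvalue `o = ±1`. -/
def pauliVec : Axis → ℤˣ → Fin 2 → ℂ
  | .x, o => ![1 / (Real.sqrt 2 : ℂ), ((o : ℤ) : ℂ) / (Real.sqrt 2 : ℂ)]
  | .y, o => ![1 / (Real.sqrt 2 : ℂ), ((o : ℤ) : ℂ) * Complex.I / (Real.sqrt 2 : ℂ)]
  | .z, o => ![(1 + ((o : ℤ) : ℂ)) / 2, (1 - ((o : ℤ) : ℂ)) / 2]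

theorem pauli_mulVec_pauliVec (a : Axis) (o : ℤˣ) :
    pauli a *ᵥ pauliVec a o = ((o : ℤ) : ℂ) • pauliVec a o := by
  rcases Int.units_eq_one_or o with rfl | rfl <;> cases a <;> ext i <;> fin_cases i <;>
    simp [pauli, pauliVec, Matrix.mulVec, dotProduct, Fin.sum_univ_two] <;>
    ring_nf <;> simp

theorem pauliVec_norm (a : Axis) (o : ℤˣ) :
    star (pauliVec a o) ⬝ᵥ pauliVec a o = 1 := by
  have h2 : (Real.sqrt 2 : ℂ) * (Real.sqrt 2 : ℂ) = 2 := by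
    rw [← Complex.ofReal_mul, Real.mul_self_sqrt (by norm_num)]; norm_num
  have h3 : (Real.sqrt 2 : ℂ)⁻¹ * (Real.sqrt 2 : ℂ)⁻¹ = 1 / 2 := by
    rw [← mul_inv, h2, one_div]
  have c2 : (starRingEnd ℂ) 2 = 2 := map_ofNat _ 2
  have hI : Complex.I * (Real.sqrt 2 : ℂ)⁻¹ * (Complex.I * (Real.sqrt 2 : ℂ)⁻¹) = -(1 / 2) := by
    rw [mul_mul_mul_comm, h3, Complex.I_mul_I]; ring
  rcases Int.units_eq_one_or o with rfl | rfl <;> cases a <;>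
    simp [pauliVec, dotProduct, Fin.sum_univ_two, div_eq_mul_inv] <;>
    norm_num [h3, c2, hI]

/-- The tensor (Kronecker) product of `k` matrices of size `2 × 2`. -/
def tensor {k : ℕ} (M : Fin k → Matrix (Fin 2) (Fin 2) ℂ) : Mat k :=
  Matrix.of fun i j => ∏ l, M l (i l) (j l)

/-- `σ_b`, the tensor product of the matrices `σ_{b_j}`. -/
def pauliString {k : ℕ} (b : PauliLabel k) : Mat k :=
  tensor fun j => pauliExt (b j)

/-- `P^s_o`, the tensor product of the projections `|e^{s_j}_{o_j}⟩⟨e^{s_j}_{o_j}|`. -/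
def outcomeProj {k : ℕ} (s : Setting k) (o : Outcome k) : Mat k :=
  tensor fun j => Matrix.vecMulVec (pauliVec (s j) (o j)) (star (pauliVec (s j) (o j)))

/-- Density matrices: positive semidefinite matrices of trace one. -/
def IsDensity {k : ℕ} (ρ : Mat k) : Prop :=
  ρ.PosSemidef ∧ ρ.trace = 1

/-- The outcome probabilities `p(o | s) = Tr(ρ P^s_o)`; the trace is real when `ρ` is a density
matrix. -/
def outcomeProb {k : ℕ} (ρ : Mat k) (s : Setting k) (o : Outcome k) : ℝ :=
  (ρ * outcomeProj s o).trace.re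

/-- The coefficients `A_b(o | s) = Tr(σ_b P^s_o)` of the measurement map. -/
def measCoeff {k : ℕ} (b : PauliLabel k) (s : Setting k) (o : Outcome k) : ℂ :=
  (pauliString b * outcomeProj s o).trace

/-- `d(b)`, the number of positions at which `b` equals `I`. -/
def numId {k : ℕ} (b : PauliLabel k) : ℕ :=
  (Finset.univ.filter fun j => b j = none).card

/-- The least squares criterion `‖f - A θ‖²` of a coefficient vector `θ`, for a table `f` of
frequencies. -/
def lsCriterion {k : ℕ} (f : Setting k → Outcome k → ℝ) (θ : PauliLabel k → ℂ) : ℝ :=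
  ∑ s, ∑ o, ‖(f s o : ℂ) - ∑ b, measCoeff b s o * θ b‖ ^ 2

/-- The Pauli coefficients of the least squares estimator. -/
def lsCoeff {k : ℕ} (f : Setting k → Outcome k → ℝ) (b : PauliLabel k) : ℂ :=
  ∑ o, ∑ s, (f s o : ℂ) * (measCoeff b s o / (2 ^ k * 3 ^ numId b))

/-- The least squares estimator computed from a table `f` of frequencies. -/
def lse {k : ℕ} (f : Setting k → Outcome k → ℝ) : Mat k :=
  ∑ b, lsCoeff f b • pauliString b

/-- The squared Frobenius norm. -/
def frobSq {k : ℕ} (M : Mat k) : ℝ :=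
  ∑ i, ∑ j, ‖M i j‖ ^ 2

/-- The operator norm with respect to the Euclidean norm. -/
def opNorm {k : ℕ} (M : Mat k) : ℝ :=
  ‖Matrix.toEuclideanCLM (n := Fin k → Fin 2) (𝕜 := ℂ) M‖

/-- `τ` is a Hermitian matrix of trace one which is closest to `M` in Frobenius norm among all
Hermitian matrices of trace one. -/
def IsTraceOneProjection {k : ℕ} (M τ : Mat k) : Prop :=
  (τ.IsHermitian ∧ τ.trace = 1) ∧
    ∀ τ' : Mat k, τ'.IsHermitian → τ'.trace = 1 → frobSq (τ - M) ≤ frobSq (τ' - M)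

/-- The measurement data: for each setting `s`, the observations `X (s, i)`, `i < n`, have law
`p(· | s)`, and all observations are independent. -/
structure IsSample {k n : ℕ} (ρ : Mat k) {Ω : Type*} [MeasurableSpace Ω] (μ : Measure Ω)
    (X : Setting k × Fin n → Ω → Outcome k) : Prop where
  measurable : ∀ a, Measurable (X a)
  indep : iIndepFun X μ
  law : ∀ a o, μ {ω | X a ω = o} = ENNReal.ofReal (outcomeProb ρ a.1 o)

/-- The count `N(o | s)` of the outcome `o` among the observations with setting `s`. -/
def count {k n : ℕ} (x : Setting k × Fin n → Outcome k) (s : Setting k) (o : Outcome k) : ℕ :=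
  (Finset.univ.filter fun i : Fin n => x (s, i) = o).card

/-- The empirical frequency `f(o | s) = N(o | s) / n`. -/
def freq {k n : ℕ} (x : Setting k × Fin n → Outcome k) (s : Setting k) (o : Outcome k) : ℝ :=
  (count x s o : ℝ) / n

/-- The rate `ν(ε)`, with `ν(ε)² = (2 / n) (2 / 3)^k log (2^(k + 1) / ε)`. -/
def nu (k n : ℕ) (ε : ℝ) : ℝ :=
  Real.sqrt (2 / n * (2 / 3) ^ k * Real.log (2 ^ (k + 1) / ε))

end Tomography

end

namespace Tomography

/-! The coefficients `A_b(o|s)` factor over the qubits and form orthogonal columns of squared length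
`2^k 3^{d(b)}` (`sum_realCoeff_mul`). The normal equations are therefore diagonal, and the criterion
is its minimum plus a positive weighted sum of squares (`lsCriterion_eq`). Traceless matrices are
Frobenius-orthogonal to the identity, so the nearest trace-one matrix is a shift by a multiple of
the identity, which translates the spectrum.

For (2), exact probabilities reproduce `ρ` (`lse_outcomeProb`), and empirical frequencies give a
matrix already of trace one, so the projection changes nothing. For a fixed unit vector the
quadratic form of the error is a normalised sum of independent bounded centred variables.
Cauchy–Schwarz and Parseval in the Pauli basis bound the squared half-ranges, summed over settings,
by `(2/3)^k`; Hoeffding's inequality follows (`IsSample.measure_expect_ge_le`). A finite net of the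
sphere passes to the operator norm. The factor 2 in `2ν` leaves room for the net: each point fails
with probability at most `2ε²`, and one spare factor `ε` absorbs the size of the net, which depends
on `k` only. -/

/-! ### Tensor products and factorisation over qubits -/

theorem sum_pi_prod {k : ℕ} {α R : Type*} [Fintype α] [CommSemiring R]
    (g : Fin k → α → R) : ∑ b : Fin k → α, ∏ j, g j (b j) = ∏ j, ∑ a, g j a := by
  rw [Finset.prod_univ_sum, Fintype.piFinset_univ]

theorem sum_sum_pi_prod {k : ℕ} {α β R : Type*} [Fintype α] [Fintype β] [CommSemiring R]
    (g : Fin k → α → β → R) :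
    ∑ s : Fin k → α, ∑ o : Fin k → β, ∏ j, g j (s j) (o j) = ∏ j, ∑ a, ∑ u, g j a u := by
  rw [← sum_pi_prod fun j a => ∑ u, g j a u]
  exact Finset.sum_congr rfl fun s _ => sum_pi_prod fun j u => g j (s j) u

theorem sum_axis {R : Type*} [AddCommMonoid R] (g : Axis → R) :
    ∑ a, g a = g .x + g .y + g .z := by
  change ∑ a ∈ ({.x, .y, .z} : Finset Axis), g a = _
  simp [add_assoc]

theorem sum_sign {R : Type*} [AddCommMonoid R] (g : ℤˣ → R) : ∑ u, g u = g 1 + g (-1) := by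
  rw [show (Finset.univ : Finset ℤˣ) = {1, -1} from rfl, Finset.sum_pair (by decide)]

theorem tensor_mul {k : ℕ} (M N : Fin k → Matrix (Fin 2) (Fin 2) ℂ) :
    tensor M * tensor N = tensor fun l => M l * N l := by
  ext i j
  simp only [tensor, Matrix.mul_apply, Matrix.of_apply, ← Finset.prod_mul_distrib]
  exact sum_pi_prod fun l a => M l (i l) a * N l a (j l)

theorem trace_tensor {k : ℕ} (M : Fin k → Matrix (Fin 2) (Fin 2) ℂ) :
    (tensor M).trace = ∏ l, (M l).trace := by
  simp only [tensor, Matrix.trace, Matrix.diag_apply, Matrix.of_apply]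
  exact sum_pi_prod fun l a => M l a a

theorem tensor_isHermitian {k : ℕ} {M : Fin k → Matrix (Fin 2) (Fin 2) ℂ}
    (hM : ∀ l, (M l).IsHermitian) : (tensor M).IsHermitian := by
  ext i j
  simp only [tensor, Matrix.conjTranspose_apply, Matrix.of_apply, star_prod]
  exact Finset.prod_congr rfl fun l _ => (hM l).apply _ _

theorem pauliExt_isHermitian (b : Option Axis) : (pauliExt b).IsHermitian := by
  rcases b with _ | a
  · exact Matrix.isHermitian_one
  · cases a <;> ext i j <;> fin_cases i <;> fin_cases j <;> simp [pauliExt, pauli]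

theorem pauliString_isHermitian {k : ℕ} (b : PauliLabel k) : (pauliString b).IsHermitian :=
  tensor_isHermitian fun l => pauliExt_isHermitian (b l)

theorem outcomeProj_isHermitian {k : ℕ} (s : Setting k) (o : Outcome k) :
    (outcomeProj s o).IsHermitian := by
  refine tensor_isHermitian fun l => ?_
  rw [Matrix.IsHermitian, Matrix.conjTranspose_vecMulVec, star_star]

/-! ### Orthogonality of the measurement coefficients -/

/-- `Tr(σ_b |e^s_o⟩⟨e^s_o|)` for a single qubit. -/
def qubitCoeff : Option Axis → Axis → ℤˣ → ℝ
  | none, _, _ => 1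
  | some a, s, o => if a = s then ((o : ℤ) : ℝ) else 0

theorem trace_pauliExt_mul (b : Option Axis) (s : Axis) (o : ℤˣ) :
    (pauliExt b * Matrix.vecMulVec (pauliVec s o) (star (pauliVec s o))).trace =
      qubitCoeff b s o := by
  rw [Matrix.mul_vecMulVec, Matrix.trace_vecMulVec, dotProduct_comm]
  rcases b with _ | a
  · simpa [pauliExt, qubitCoeff] using pauliVec_norm s o
  by_cases h : a = s
  · subst h
    rw [pauliExt, pauli_mulVec_pauliVec, dotProduct_smul, pauliVec_norm]
    simp [qubitCoeff]
  · have h2 : (Real.sqrt 2 : ℂ)⁻¹ * (Real.sqrt 2 : ℂ)⁻¹ = 1 / 2 := by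
      rw [← mul_inv, ← Complex.ofReal_mul, Real.mul_self_sqrt (by norm_num)]; norm_num
    rcases Int.units_eq_one_or o with rfl | rfl <;> cases a <;> cases s <;>
      first
      | exact absurd rfl h
      | (simp [pauliExt, pauli, pauliVec, qubitCoeff, Matrix.mulVec, dotProduct, Fin.sum_univ_two,
          div_eq_mul_inv]
         try first | ring1 | linear_combination (1 + Complex.I ^ 2) * h2 + Complex.I_sq / 2)

/-- The coefficients `A_b(o | s)` as real numbers. -/
def realCoeff {k : ℕ} (b : PauliLabel k) (s : Setting k) (o : Outcome k) : ℝ :=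
  ∏ j, qubitCoeff (b j) (s j) (o j)

theorem measCoeff_eq {k : ℕ} (b : PauliLabel k) (s : Setting k) (o : Outcome k) :
    measCoeff b s o = realCoeff b s o := by
  simp only [measCoeff, pauliString, outcomeProj, tensor_mul, trace_tensor, trace_pauliExt_mul,
    realCoeff, Complex.ofReal_prod]

/-- The identity collects 1 from all six pairs, an axis only from the two outcomes of its own
setting. For distinct labels the supports are disjoint or the signs cancel. -/
theorem sum_qubitCoeff_mul (b b' : Option Axis) :
    ∑ s, ∑ o, qubitCoeff b s o * qubitCoeff b' s o =
      if b = b' then 2 * (if b = none then 3 else 1) else 0 := by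
  rcases b with _ | a <;> rcases b' with _ | a'
  · simp only [qubitCoeff, sum_axis, sum_sign]; norm_num
  · simp [qubitCoeff]
  · simp [qubitCoeff]
  · simp only [qubitCoeff, sum_axis, sum_sign]
    cases a <;> cases a' <;> simp <;> norm_num

theorem prod_ite_none {k : ℕ} (b : PauliLabel k) (c : ℝ) :
    ∏ j, (if b j = none then c else 1) = c ^ numId b := by
  rw [Finset.prod_ite, Finset.prod_const, Finset.prod_const_one, mul_one, numId]

theorem sum_realCoeff_mul {k : ℕ} (b b' : PauliLabel k) :
    ∑ s, ∑ o, realCoeff b s o * realCoeff b' s o =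
      if b = b' then 2 ^ k * 3 ^ numId b else 0 := by
  simp only [realCoeff, ← Finset.prod_mul_distrib]
  rw [sum_sum_pi_prod fun j a u => qubitCoeff (b j) a u * qubitCoeff (b' j) a u]
  simp only [sum_qubitCoeff_mul]
  split_ifs with h
  · subst h
    simp only [if_true, Finset.prod_mul_distrib, prod_ite_none]
    simp
  · obtain ⟨j, hj⟩ := Function.ne_iff.mp h
    exact Finset.prod_eq_zero (Finset.mem_univ j) (if_neg hj)

/-! ### Pauli expansion and unbiasedness -/

/-- This is `∑ σ ⊗ σ = 2 · SWAP`, the source of the completeness relation and of Parseval's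
identity. -/
theorem sum_pauliExt_mul (i j i' j' : Fin 2) :
    ∑ b, pauliExt b i j * pauliExt b i' j' = if i = j' ∧ j = i' then 2 else 0 := by
  rw [Fintype.sum_option, sum_axis]
  fin_cases i <;> fin_cases j <;> fin_cases i' <;> fin_cases j' <;>
    simp [pauliExt, pauli] <;> norm_num

theorem sum_pauliString_mul {k : ℕ} (i j i' j' : Fin k → Fin 2) :
    ∑ b, pauliString b i j * pauliString b i' j' = if i = j' ∧ j = i' then 2 ^ k else 0 := by
  simp only [pauliString, tensor, Matrix.of_apply, ← Finset.prod_mul_distrib]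
  rw [sum_pi_prod fun l β => pauliExt β (i l) (j l) * pauliExt β (i' l) (j' l)]
  simp only [sum_pauliExt_mul]
  split_ifs with h
  · obtain ⟨rfl, rfl⟩ := h
    simp
  · obtain ⟨l, hl⟩ : ∃ l, ¬(i l = j' l ∧ j l = i' l) := by
      by_contra! hc
      exact h ⟨funext fun l => (hc l).1, funext fun l => (hc l).2⟩
    exact Finset.prod_eq_zero (Finset.mem_univ l) (if_neg hl)

/-- Expansion of a matrix in the Pauli basis. -/
theorem sum_trace_smul_pauliString {k : ℕ} (M : Mat k) :
    ∑ b, (M * pauliString b).trace • pauliString b = (2 ^ k : ℂ) • M := by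
  ext i' j'
  simp only [Matrix.sum_apply, Matrix.smul_apply, smul_eq_mul, Matrix.trace, Matrix.diag_apply,
    Matrix.mul_apply, Finset.sum_mul]
  rw [Finset.sum_comm]
  simp_rw [Finset.sum_comm (s := (Finset.univ : Finset (PauliLabel k))), mul_assoc,
    ← Finset.mul_sum, sum_pauliString_mul]
  rw [Finset.sum_eq_single i', Finset.sum_eq_single j'] <;> simp +contextual [mul_comm]

theorem sum_trace_mul_trace {k : ℕ} (M N : Mat k) :
    ∑ b, (M * pauliString b).trace * (N * pauliString b).trace = 2 ^ k * (N * M).trace := by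
  have h := congrArg (fun K => (N * K).trace) (sum_trace_smul_pauliString M)
  simpa [Finset.mul_sum, Matrix.trace_sum] using h

theorem trace_mul_conj_of_isHermitian {k : ℕ} {M N : Mat k} (hM : M.IsHermitian)
    (hN : N.IsHermitian) : (((M * N).trace.re : ℝ) : ℂ) = (M * N).trace := by
  rw [← Complex.conj_eq_iff_re, starRingEnd_apply, ← Matrix.trace_conjTranspose,
    Matrix.conjTranspose_mul, hM.eq, hN.eq, Matrix.trace_mul_comm]

theorem outcomeProb_eq {k : ℕ} {ρ : Mat k} (hρ : ρ.IsHermitian) (s : Setting k) (o : Outcome k) :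
    outcomeProb ρ s o = (ρ * outcomeProj s o).trace :=
  trace_mul_conj_of_isHermitian hρ (outcomeProj_isHermitian s o)

theorem two_pow_mul_outcomeProb {k : ℕ} {ρ : Mat k} (hρ : ρ.IsHermitian) (s : Setting k)
    (o : Outcome k) :
    2 ^ k * (outcomeProb ρ s o : ℂ) = ∑ b, realCoeff b s o * (ρ * pauliString b).trace := by
  rw [outcomeProb_eq hρ, ← sum_trace_mul_trace]
  refine Finset.sum_congr rfl fun b _ => ?_
  rw [← measCoeff_eq, measCoeff, Matrix.trace_mul_comm (pauliString b)]

theorem lsCoeff_eq {k : ℕ} (f : Setting k → Outcome k → ℝ) (b : PauliLabel k) :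
    lsCoeff f b = ((∑ s, ∑ o, f s o * realCoeff b s o : ℝ) : ℂ) / (2 ^ k * 3 ^ numId b) := by
  rw [lsCoeff, Finset.sum_comm]
  simp only [measCoeff_eq, Complex.ofReal_sum, Complex.ofReal_mul, Finset.sum_div, mul_div_assoc]

/-- Born probabilities are combinations of the columns `A_b`; orthogonality of the columns isolates
each Pauli coefficient of `ρ`. -/
theorem lsCoeff_outcomeProb {k : ℕ} {ρ : Mat k} (hρ : ρ.IsHermitian) (b : PauliLabel k) :
    lsCoeff (outcomeProb ρ) b = (ρ * pauliString b).trace / 2 ^ k := by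
  have h : (2 ^ k : ℂ) * ((∑ s, ∑ o, outcomeProb ρ s o * realCoeff b s o : ℝ) : ℂ) =
      2 ^ k * 3 ^ numId b * (ρ * pauliString b).trace := by
    push_cast
    simp_rw [Finset.mul_sum, ← mul_assoc, two_pow_mul_outcomeProb hρ, Finset.sum_mul]
    rw [Finset.sum_congr rfl fun s _ => Finset.sum_comm, Finset.sum_comm]
    refine (Finset.sum_congr rfl fun b' _ => (?_ : _ = ((∑ s, ∑ o, realCoeff b' s o *
      realCoeff b s o : ℝ) : ℂ) * (ρ * pauliString b').trace)).trans ?_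
    · push_cast
      simp only [Finset.sum_mul]
      exact Finset.sum_congr rfl fun s _ => Finset.sum_congr rfl fun o _ => mul_right_comm _ _ _
    · simp [sum_realCoeff_mul, apply_ite Complex.ofReal]
  have h2 : (2 ^ k : ℂ) ≠ 0 := by simp
  have h3 : (3 ^ numId b : ℂ) ≠ 0 := by simp
  rw [lsCoeff_eq]
  field_simp
  rw [mul_assoc] at h
  exact mul_left_cancel₀ h2 h

theorem lse_outcomeProb {k : ℕ} {ρ : Mat k} (hρ : ρ.IsHermitian) : lse (outcomeProb ρ) = ρ := by
  have h2 : (2 ^ k : ℂ) ≠ 0 := by simp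
  simp only [lse, lsCoeff_outcomeProb hρ, div_eq_inv_mul, mul_smul, ← Finset.smul_sum,
    sum_trace_smul_pauliString, inv_smul_smul₀ h2]

theorem lse_sub {k : ℕ} (f g : Setting k → Outcome k → ℝ) : lse (f - g) = lse f - lse g := by
  simp only [lse, lsCoeff, ← Finset.sum_sub_distrib, ← sub_smul, ← sub_mul, Pi.sub_apply,
    Complex.ofReal_sub]

theorem lse_isHermitian {k : ℕ} (f : Setting k → Outcome k → ℝ) : (lse f).IsHermitian := by
  rw [Matrix.IsHermitian, lse, Matrix.conjTranspose_sum]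
  refine Finset.sum_congr rfl fun b _ => ?_
  rw [Matrix.conjTranspose_smul, (pauliString_isHermitian b).eq, lsCoeff_eq]
  congr 1
  simp

/-! ### The least squares minimiser -/

/-- Pythagoras: the residual at `lsCoeff f` is orthogonal to every column. -/
theorem lsCriterion_eq {k : ℕ} (f : Setting k → Outcome k → ℝ) (θ : PauliLabel k → ℂ) :
    lsCriterion f θ = lsCriterion f (lsCoeff f) +
      ∑ b, 2 ^ k * 3 ^ numId b * ‖θ b - lsCoeff f b‖ ^ 2 := by
  set η : PauliLabel k → ℂ := fun b => θ b - lsCoeff f b with hη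
  set u : Setting k → Outcome k → ℂ :=
    fun s o => (f s o : ℂ) - ∑ b, measCoeff b s o * lsCoeff f b with hu
  have hdec : ∀ s o, (f s o : ℂ) - ∑ b, measCoeff b s o * θ b =
      u s o - ∑ b, realCoeff b s o * η b := fun s o => by
    simp only [hu, hη, measCoeff_eq, mul_sub, Finset.sum_sub_distrib]
    ring
  have hpair : ∀ (w : PauliLabel k → ℂ) (b : PauliLabel k),
      ∑ s, ∑ o, (∑ b', realCoeff b' s o * w b') * realCoeff b s o =
        2 ^ k * 3 ^ numId b * w b := fun w b => by
    simp_rw [Finset.sum_mul]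
    rw [Finset.sum_congr rfl fun s _ => Finset.sum_comm, Finset.sum_comm]
    refine (Finset.sum_congr rfl fun b' _ => (?_ : _ = ((∑ s, ∑ o, realCoeff b' s o *
      realCoeff b s o : ℝ) : ℂ) * w b')).trans ?_
    · push_cast
      simp only [Finset.sum_mul]
      exact Finset.sum_congr rfl fun s _ => Finset.sum_congr rfl fun o _ => mul_right_comm _ _ _
    · simp [sum_realCoeff_mul, apply_ite Complex.ofReal]
  have horth : ∀ b, ∑ s, ∑ o, u s o * realCoeff b s o = 0 := fun b => by
    have h2 : (2 ^ k : ℂ) ≠ 0 := by simp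
    have h3 : (3 ^ numId b : ℂ) ≠ 0 := by simp
    simp only [hu, measCoeff_eq, sub_mul, Finset.sum_sub_distrib, hpair, lsCoeff_eq]
    push_cast
    field_simp
    ring
  have hcross : ∀ w : PauliLabel k → ℂ,
      ∑ s, ∑ o, u s o * ∑ b, realCoeff b s o * w b = 0 := fun w => by
    simp_rw [Finset.mul_sum]
    rw [Finset.sum_congr rfl fun s _ => Finset.sum_comm, Finset.sum_comm]
    refine Finset.sum_eq_zero fun b _ => ?_
    simp_rw [← mul_assoc, ← Finset.sum_mul, horth, zero_mul]
  -- The coefficients are real, so conjugation falls on `η` alone; the cross term is then again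
  -- linear in the columns and `hcross` removes it.
  have hsq : ∀ s o, ‖u s o - ∑ b, realCoeff b s o * η b‖ ^ 2 = ‖u s o‖ ^ 2 +
      (-2 * (u s o * ∑ b, realCoeff b s o * star (η b)).re +
        ((∑ b, realCoeff b s o * η b) * ∑ b, realCoeff b s o * star (η b)).re) := fun s o => by
    have hstar : ∑ b, (realCoeff b s o : ℂ) * star (η b) = star (∑ b, realCoeff b s o * η b) := by
      simp
    rw [hstar]
    generalize ∑ b, (realCoeff b s o : ℂ) * η b = z
    simp only [Complex.sq_norm, Complex.normSq_apply, Complex.sub_re, Complex.sub_im,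
      Complex.mul_re, Complex.star_def, Complex.conj_re, Complex.conj_im]
    ring
  have hnorm : ∑ s, ∑ o, (∑ b, realCoeff b s o * η b) * ∑ b, realCoeff b s o * star (η b) =
      ((∑ b, 2 ^ k * 3 ^ numId b * ‖η b‖ ^ 2 : ℝ) : ℂ) := by
    simp_rw [Finset.mul_sum, ← mul_assoc]
    rw [Finset.sum_congr rfl fun s _ => Finset.sum_comm, Finset.sum_comm]
    push_cast
    refine Finset.sum_congr rfl fun b _ => ?_
    simp_rw [← Finset.sum_mul, hpair, mul_assoc]
    rw [Complex.star_def, Complex.mul_conj']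
  simp only [lsCriterion, hdec, hsq, Finset.sum_add_distrib, ← Finset.mul_sum,
    ← Complex.re_sum, hcross, hnorm, Complex.ofReal_re, Complex.zero_re, mul_zero, zero_add]
  rfl

theorem lsCriterion_lsCoeff_lt {k : ℕ} (f : Setting k → Outcome k → ℝ) {θ : PauliLabel k → ℂ}
    (hθ : θ ≠ lsCoeff f) : lsCriterion f (lsCoeff f) < lsCriterion f θ := by
  rw [lsCriterion_eq f θ]
  obtain ⟨b, hb⟩ := Function.ne_iff.mp hθ
  have hb' : 0 < ‖θ b - lsCoeff f b‖ := norm_pos_iff.mpr (sub_ne_zero.mpr hb)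
  refine lt_add_of_pos_right _ (Finset.sum_pos' (fun b _ => by positivity)
    ⟨b, Finset.mem_univ b, by positivity⟩)

/-! ### Projection onto trace one and its spectrum -/

theorem frobSq_add_smul_one {k : ℕ} (D : Mat k) (hD : D.trace = 0) (c : ℝ) :
    frobSq (D + (c : ℂ) • 1) = frobSq D + c ^ 2 * 2 ^ k := by
  have h : ∀ i j, ‖(D + (c : ℂ) • (1 : Mat k)) i j‖ ^ 2 =
      ‖D i j‖ ^ 2 + if i = j then 2 * c * (D i j).re + c ^ 2 else 0 := fun i j => by
    rcases eq_or_ne i j with rfl | hij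
    · simp only [Matrix.add_apply, Matrix.smul_apply, Matrix.one_apply_eq, smul_eq_mul, mul_one,
        if_true, Complex.sq_norm, Complex.normSq_apply, Complex.add_re, Complex.add_im,
        Complex.ofReal_re, Complex.ofReal_im]
      ring
    · simp [hij]
  have htr : ∑ i, (D i i).re = 0 := by
    simpa [Matrix.trace, Complex.re_sum] using congrArg Complex.re hD
  simp only [frobSq, h, Finset.sum_add_distrib, Finset.sum_ite_eq, Finset.mem_univ, if_true,
    ← Finset.mul_sum, htr]
  simp [mul_comm]

theorem frobSq_eq_zero {k : ℕ} {D : Mat k} (h : frobSq D = 0) : D = 0 := by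
  ext i j
  have h1 := (Finset.sum_eq_zero_iff_of_nonneg fun i _ =>
    Finset.sum_nonneg fun j _ => sq_nonneg ‖D i j‖).mp h i (Finset.mem_univ i)
  have h2 := (Finset.sum_eq_zero_iff_of_nonneg fun j _ => sq_nonneg ‖D i j‖).mp h1 j
    (Finset.mem_univ j)
  simpa using h2

theorem frobSq_nonneg {k : ℕ} (D : Mat k) : 0 ≤ frobSq D :=
  Finset.sum_nonneg fun _ _ => Finset.sum_nonneg fun _ _ => by positivity

/-- For `τ'` of trace one, `τ' - τ₀` is traceless, hence orthogonal to `τ₀ - M = c • 1`; the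
distance splits by Pythagoras. -/
theorem isTraceOneProjection_iff {k : ℕ} {M : Mat k} (hM : M.IsHermitian) (τ : Mat k) :
    IsTraceOneProjection M τ ↔ τ = M + (((1 - M.trace.re) / 2 ^ k : ℝ) : ℂ) • 1 := by
  set c : ℝ := (1 - M.trace.re) / 2 ^ k with hc
  set τ₀ : Mat k := M + (c : ℂ) • 1 with hτ₀
  have hreal : ((M.trace.re : ℝ) : ℂ) = M.trace := by
    simpa using trace_mul_conj_of_isHermitian hM (Matrix.isHermitian_one (n := Fin k → Fin 2))
  have htr : τ₀.trace = 1 := by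
    have h2 : (2 ^ k : ℂ) ≠ 0 := by simp
    rw [hτ₀, hc, Matrix.trace_add, Matrix.trace_smul, Matrix.trace_one]
    push_cast
    rw [hreal]
    simp
  have hherm : τ₀.IsHermitian := by
    refine hM.add ?_
    rw [Matrix.IsHermitian, Matrix.conjTranspose_smul, Matrix.conjTranspose_one]
    simp
  have key : ∀ τ' : Mat k, τ'.trace = 1 → frobSq (τ' - M) = frobSq (τ' - τ₀) + c ^ 2 * 2 ^ k := by
    intro τ' h1
    rw [← frobSq_add_smul_one _ (by rw [Matrix.trace_sub, h1, htr, sub_self]) c]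
    congr 1
    rw [hτ₀]; abel
  have hzero : frobSq (τ₀ - τ₀) = 0 := by simp [frobSq]
  constructor
  · rintro ⟨⟨-, h1⟩, hmin⟩
    have := hmin τ₀ hherm htr
    rw [key τ h1, key τ₀ htr, hzero] at this
    exact sub_eq_zero.mp (frobSq_eq_zero (le_antisymm (by linarith) (frobSq_nonneg _)))
  · rintro rfl
    refine ⟨⟨hherm, htr⟩, fun τ' _ h1 => ?_⟩
    rw [key τ' h1, key τ₀ htr, hzero]
    linarith [frobSq_nonneg (τ' - τ₀)]

/-- The characteristic polynomials differ by a translation, hence so do the root multisets.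
Translation preserves order, so the sorted lists match index by index. -/
theorem eigenvalues₀_add_smul_one {n : Type*} [Fintype n] [DecidableEq n] {M τ : Matrix n n ℂ}
    (hM : M.IsHermitian) (hτ : τ.IsHermitian) {c : ℝ} (h : τ = M + (c : ℂ) • 1)
    (j : Fin (Fintype.card n)) : hτ.eigenvalues₀ j = hM.eigenvalues₀ j + c := by
  have hch : M.charpoly = τ.charpoly.comp (Polynomial.X + Polynomial.C (c : ℂ)) := by
    rw [← Matrix.charpoly_sub_scalar]
    congr 1
    rw [h, Matrix.scalar_apply, ← Matrix.smul_one_eq_diagonal, add_sub_cancel_right]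
  have hroots : M.charpoly.roots = τ.charpoly.roots.map fun z => z - (c : ℂ) := by
    have hlin : ∀ i, ((Polynomial.X - Polynomial.C (RCLike.ofReal (hτ.eigenvalues i) : ℂ)).comp
        (Polynomial.X + Polynomial.C (c : ℂ))) =
        Polynomial.X - Polynomial.C ((hτ.eigenvalues i : ℂ) - c) := fun i => by
      simp [sub_eq_add_neg, add_assoc, add_comm]
    rw [hτ.roots_charpoly_eq_eigenvalues, hch, hτ.charpoly_eq, Polynomial.prod_comp,
      Finset.prod_congr rfl fun i _ => (hlin i :), Polynomial.roots_prod _ _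
      (Finset.prod_ne_zero_iff.mpr fun i _ => Polynomial.X_sub_C_ne_zero _)]
    simp only [Polynomial.roots_X_sub_C, Multiset.bind_singleton, Multiset.map_map]
    rfl
  have hsort := hM.sort_roots_charpoly_eq_eigenvalues₀
  have hanti : Antitone fun j => hτ.eigenvalues₀ j - c := fun i j hij =>
    sub_le_sub_right (hτ.eigenvalues₀_antitone hij) c
  have : hM.eigenvalues₀ = fun j => hτ.eigenvalues₀ j - c := by
    rw [← List.ofFn_inj, ← hsort, hroots, hτ.roots_charpoly_eq_eigenvalues₀]
    simp_rw [Fin.univ_val_map, Multiset.map_coe, List.map_ofFn, Function.comp_def,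
      Multiset.coe_sort]
    simp only [Complex.coe_algebraMap, Complex.sub_re, RCLike.re_to_complex, Complex.ofReal_re]
    apply List.mergeSort_of_pairwise
    simp_rw [decide_eq_true_eq, ← List.sortedGE_iff_pairwise]
    exact hanti.sortedGE_ofFn
  rw [this]
  ring

theorem sum_eigenvalues₀ {n : Type*} [Fintype n] [DecidableEq n] {M : Matrix n n ℂ}
    (hM : M.IsHermitian) : ∑ j, hM.eigenvalues₀ j = M.trace.re := by
  rw [hM.trace_eq_sum_eigenvalues, Complex.re_sum]
  exact (Equiv.sum_comp (Fintype.equivOfCardEq (Fintype.card_fin _)).symm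
    hM.eigenvalues₀).symm

/-! ### Quadratic forms of the estimator -/

/-- `⟨v, M v⟩ = Tr(|v⟩⟨v| M)`. -/
def expect {k : ℕ} (v : (Fin k → Fin 2) → ℂ) (M : Mat k) : ℂ :=
  (Matrix.vecMulVec v (star v) * M).trace

/-- The expectation of the Pauli string `σ_b` in the vector `v`. -/
def pauliExpect {k : ℕ} (v : (Fin k → Fin 2) → ℂ) (b : PauliLabel k) : ℝ :=
  (expect v (pauliString b)).re

/-- The contribution of the outcome `o` under the setting `s` to `⟨v, lse f v⟩`. -/
noncomputable def outcomeWeight {k : ℕ} (v : (Fin k → Fin 2) → ℂ) (s : Setting k) (o : Outcome k) : ℝ :=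
  ∑ b, realCoeff b s o * pauliExpect v b / (2 ^ k * 3 ^ numId b)

theorem vecMulVec_isHermitian {k : ℕ} (v : (Fin k → Fin 2) → ℂ) :
    (Matrix.vecMulVec v (star v)).IsHermitian := by
  rw [Matrix.IsHermitian, Matrix.conjTranspose_vecMulVec, star_star]

theorem ofReal_pauliExpect {k : ℕ} (v : (Fin k → Fin 2) → ℂ) (b : PauliLabel k) :
    (pauliExpect v b : ℂ) = expect v (pauliString b) :=
  trace_mul_conj_of_isHermitian (vecMulVec_isHermitian v) (pauliString_isHermitian b)

theorem expect_lse {k : ℕ} (v : (Fin k → Fin 2) → ℂ) (f : Setting k → Outcome k → ℝ) :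
    expect v (lse f) = ((∑ s, ∑ o, f s o * outcomeWeight v s o : ℝ) : ℂ) := by
  have h1 : expect v (lse f) = ∑ b, lsCoeff f b * pauliExpect v b := by
    simp only [ofReal_pauliExpect, expect, lse, Finset.mul_sum, Matrix.trace_sum,
      Matrix.mul_smul, Matrix.trace_smul, smul_eq_mul]
  rw [h1]
  simp only [lsCoeff_eq, outcomeWeight, Finset.mul_sum]
  rw [Finset.sum_congr rfl fun s _ => Finset.sum_comm, Finset.sum_comm]
  push_cast
  refine Finset.sum_congr rfl fun b _ => ?_
  simp only [Finset.sum_div, Finset.sum_mul]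
  refine Finset.sum_congr rfl fun s _ => Finset.sum_congr rfl fun o _ => by ring

/-- Parseval for the projector onto `v`, whose square has trace one. -/
theorem sum_pauliExpect_sq {k : ℕ} {v : (Fin k → Fin 2) → ℂ} (hv : star v ⬝ᵥ v = 1) :
    ∑ b, pauliExpect v b ^ 2 = 2 ^ k := by
  have h := sum_trace_mul_trace (Matrix.vecMulVec v (star v)) (Matrix.vecMulVec v (star v))
  rw [Matrix.vecMulVec_mul_vecMulVec, hv, one_smul, Matrix.trace_vecMulVec, dotProduct_comm, hv,
    mul_one] at h
  have h' : ((∑ b, pauliExpect v b ^ 2 : ℝ) : ℂ) = ((2 ^ k : ℝ) : ℂ) := by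
    push_cast
    simp only [ofReal_pauliExpect, pow_two]
    exact h
  exact_mod_cast h'

/-- Whether the single-qubit observable `σ_b` can be evaluated from a measurement of `σ_s`. -/
def qubitCompat : Option Axis → Axis → ℝ
  | none, _ => 1
  | some a, s => if a = s then 1 else 0

/-- The indicator of the labels `b` with `b_j ∈ {I, s_j}` for all `j`. -/
def compat {k : ℕ} (b : PauliLabel k) (s : Setting k) : ℝ :=
  ∏ j, qubitCompat (b j) (s j)

theorem qubitCoeff_sq (b : Option Axis) (s : Axis) (o : ℤˣ) :
    qubitCoeff b s o ^ 2 = qubitCompat b s := by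
  rcases b with _ | a
  · simp [qubitCoeff, qubitCompat]
  · rcases Int.units_eq_one_or o with rfl | rfl <;> by_cases h : a = s <;>
      simp [qubitCoeff, qubitCompat, h]

theorem realCoeff_sq {k : ℕ} (b : PauliLabel k) (s : Setting k) (o : Outcome k) :
    realCoeff b s o ^ 2 = compat b s := by
  simp only [realCoeff, compat, ← Finset.prod_pow, qubitCoeff_sq]

theorem compat_nonneg {k : ℕ} (b : PauliLabel k) (s : Setting k) : 0 ≤ compat b s := by
  rw [← realCoeff_sq b s 1]
  positivity

theorem sum_compat {k : ℕ} (b : PauliLabel k) : ∑ s, compat b s = 3 ^ numId b := by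
  have h : ∀ β : Option Axis, ∑ a, qubitCompat β a = if β = none then 3 else 1 := by
    rintro (_ | a)
    · simp only [qubitCompat, sum_axis]; norm_num
    · simp [qubitCompat]
  simp only [compat]
  rw [sum_pi_prod fun j a => qubitCompat (b j) a]
  simp only [h, prod_ite_none]

/-- At each site `I` contributes 1 and the one matching axis 3. -/
theorem sum_compat_div {k : ℕ} (s : Setting k) :
    ∑ b, compat b s * (3 ^ k / 3 ^ numId b) = 4 ^ k := by
  have h : ∀ b : PauliLabel k, compat b s * (3 ^ k / 3 ^ numId b) =
      ∏ j, qubitCompat (b j) (s j) * (3 / if b j = none then 3 else 1) := fun b => by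
    rw [Finset.prod_mul_distrib, Finset.prod_div_distrib, prod_ite_none]
    simp [compat]
  have h' : ∀ a : Axis, ∑ β, qubitCompat β a * (3 / if β = none then 3 else 1) = 4 := fun a => by
    rw [Fintype.sum_option, sum_axis]
    cases a <;> simp [qubitCompat] <;> norm_num
  simp only [h]
  rw [sum_pi_prod fun j β => qubitCompat β (s j) * (3 / if β = none then 3 else 1)]
  simp [h']

/-- A bound for the squares of the weights `outcomeWeight v s o`. -/
noncomputable def weightBound {k : ℕ} (v : (Fin k → Fin 2) → ℂ) (s : Setting k) : ℝ :=
  ∑ b, compat b s * pauliExpect v b ^ 2 / (3 ^ k * 3 ^ numId b)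

theorem weightBound_nonneg {k : ℕ} (v : (Fin k → Fin 2) → ℂ) (s : Setting k) :
    0 ≤ weightBound v s :=
  Finset.sum_nonneg fun b _ => by have := compat_nonneg b s; positivity

theorem outcomeWeight_sq_le {k : ℕ} (v : (Fin k → Fin 2) → ℂ) (s : Setting k) (o : Outcome k) :
    outcomeWeight v s o ^ 2 ≤ weightBound v s := by
  -- Cauchy–Schwarz with the weights `3^k / 3^{d(b)}`: their sum `4^k` is the same for every
  -- setting, and the second factor has a total over `s` that Parseval evaluates exactly.
  have h := Finset.sum_sq_le_sum_mul_sum_of_sq_le_mul (Finset.univ : Finset (PauliLabel k))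
    (f := fun b => compat b s * (3 ^ k / 3 ^ numId b))
    (g := fun b => compat b s * pauliExpect v b ^ 2 / (3 ^ k * 3 ^ numId b) / 4 ^ k)
    (r := fun b => realCoeff b s o * pauliExpect v b / (2 ^ k * 3 ^ numId b))
    (fun b _ => by have := compat_nonneg b s; positivity)
    (fun b _ => by have := compat_nonneg b s; positivity)
    (fun b _ => le_of_eq <| by
      have h4 : compat b s * compat b s = compat b s := by
        simp only [compat, ← Finset.prod_mul_distrib]
        refine Finset.prod_congr rfl fun j _ => ?_
        rcases b j with _ | a <;> simp [qubitCompat]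
      have h5 : (4 : ℝ) ^ k = 2 ^ k * 2 ^ k := by rw [← mul_pow]; norm_num
      rw [div_pow, mul_pow, realCoeff_sq, h5]
      field_simp
      linear_combination -(pauliExpect v b ^ 2) * h4)
  rw [sum_compat_div, ← Finset.sum_div, mul_div_cancel₀ _ (by positivity)] at h
  exact h

theorem sum_weightBound {k : ℕ} {v : (Fin k → Fin 2) → ℂ} (hv : star v ⬝ᵥ v = 1) :
    ∑ s, weightBound v s = (2 / 3) ^ k := by
  simp only [weightBound]
  rw [Finset.sum_comm]
  have h : ∀ b : PauliLabel k, ∑ s, compat b s * pauliExpect v b ^ 2 / (3 ^ k * 3 ^ numId b) =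
      pauliExpect v b ^ 2 / 3 ^ k := fun b => by
    rw [← Finset.sum_div, ← Finset.sum_mul, sum_compat]
    field_simp
  simp only [h]
  rw [← Finset.sum_div, sum_pauliExpect_sq hv, div_pow]

/-! ### Concentration for a fixed vector -/

theorem outcomeProj_eq_vecMulVec {k : ℕ} (s : Setting k) (o : Outcome k) :
    outcomeProj s o = Matrix.vecMulVec (fun i => ∏ l, pauliVec (s l) (o l) (i l))
      (star fun i => ∏ l, pauliVec (s l) (o l) (i l)) := by
  ext i j
  simp [outcomeProj, tensor, Matrix.vecMulVec_apply, Finset.prod_mul_distrib]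

theorem outcomeProb_nonneg {k : ℕ} {ρ : Mat k} (hρ : ρ.PosSemidef) (s : Setting k)
    (o : Outcome k) : 0 ≤ outcomeProb ρ s o := by
  rw [outcomeProb, outcomeProj_eq_vecMulVec, Matrix.mul_vecMulVec, Matrix.trace_vecMulVec,
    dotProduct_comm]
  exact hρ.re_dotProduct_nonneg _

theorem sum_freq_mul {k n : ℕ} (x : Setting k × Fin n → Outcome k) (s : Setting k)
    (h : Outcome k → ℝ) : n * ∑ o, freq x s o * h o = ∑ i, h (x (s, i)) := by
  rcases Nat.eq_zero_or_pos n with rfl | hn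
  · simp
  have hn' : (n : ℝ) ≠ 0 := by positivity
  have hc : ∀ o, n * (freq x s o * h o) = ∑ i : Fin n, if x (s, i) = o then h o else 0 :=
    fun o => by
      rw [freq, count, Finset.card_filter]
      push_cast
      field_simp
      simp [← Finset.sum_filter]
  rw [Finset.mul_sum, Finset.sum_congr rfl fun o _ => hc o, Finset.sum_comm]
  simp

theorem IsSample.integral_comp {k n : ℕ} {ρ : Mat k} (hρ : ρ.PosSemidef) {Ω : Type*}
    [MeasurableSpace Ω] {μ : Measure Ω} [IsProbabilityMeasure μ]
    {X : Setting k × Fin n → Ω → Outcome k} (hX : IsSample ρ μ X) (a : Setting k × Fin n)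
    (h : Outcome k → ℝ) : ∫ ω, h (X a ω) ∂μ = ∑ o, outcomeProb ρ a.1 o * h o := by
  have := Measure.isProbabilityMeasure_map (μ := μ) (hX.measurable a).aemeasurable
  rw [← integral_map (hX.measurable a).aemeasurable
    (measurable_of_finite h).aestronglyMeasurable, integral_fintype (.of_finite)]
  refine Finset.sum_congr rfl fun o _ => ?_
  rw [measureReal_def, Measure.map_apply (hX.measurable a) (measurableSet_singleton o),
    Set.preimage, smul_eq_mul]
  simp only [Set.mem_singleton_iff, hX.law,
    ENNReal.toReal_ofReal (outcomeProb_nonneg hρ a.1 o)]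

theorem IsSample.measure_expect_ge_le {k n : ℕ} (hn : 1 ≤ n) {ρ : Mat k} (hρ : ρ.PosSemidef)
    {Ω : Type*} [MeasurableSpace Ω] {μ : Measure Ω} [IsProbabilityMeasure μ]
    {X : Setting k × Fin n → Ω → Outcome k} (hX : IsSample ρ μ X) {v : (Fin k → Fin 2) → ℂ}
    (hv : star v ⬝ᵥ v = 1) {t : ℝ} (ht : 0 ≤ t) :
    μ.real {ω | t ≤ |(expect v (lse (freq fun a => X a ω) - ρ)).re|} ≤
      2 * Real.exp (-(n * t ^ 2) / (2 * (2 / 3) ^ k)) := by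
  have hn' : (0 : ℝ) < n := by exact_mod_cast hn
  set Y : Setting k × Fin n → Ω → ℝ := fun a ω =>
    outcomeWeight v a.1 (X a ω) - ∫ ω', outcomeWeight v a.1 (X a ω') ∂μ with hY
  have hsum : ∀ ω, ∑ a, Y a ω = n * (expect v (lse (freq fun a => X a ω) - ρ)).re := fun ω => by
    have h1 : lse (freq fun a => X a ω) - ρ = lse ((freq fun a => X a ω) - outcomeProb ρ) := by
      rw [lse_sub, lse_outcomeProb hρ.isHermitian]
    rw [h1, expect_lse, Complex.ofReal_re, Finset.mul_sum, Fintype.sum_prod_type]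
    refine Finset.sum_congr rfl fun s _ => ?_
    simp only [hY, hX.integral_comp hρ, Finset.sum_sub_distrib, Pi.sub_apply, sub_mul, mul_sub,
      sum_freq_mul]
    simp
  have hindep : iIndepFun Y μ := hX.indep.comp
    (fun a o => outcomeWeight v a.1 o - ∫ ω', outcomeWeight v a.1 (X a ω') ∂μ)
    fun a => measurable_of_finite _
  -- Hoeffding's lemma: the parameter is the squared half-length of the range, which is `weightBound
  -- v s`.
  set c : Setting k × Fin n → NNReal := fun a =>
    (‖Real.sqrt (weightBound v a.1) - -Real.sqrt (weightBound v a.1)‖₊ / 2) ^ 2 with hc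
  have hsub : ∀ a ∈ (Finset.univ : Finset (Setting k × Fin n)), HasSubgaussianMGF (Y a) (c a) μ :=
    fun a _ => hasSubgaussianMGF_of_mem_Icc
      ((measurable_of_finite (outcomeWeight v a.1)).comp (hX.measurable a)).aemeasurable
      (ae_of_all _ fun ω => abs_le.mp (Real.abs_le_sqrt (outcomeWeight_sq_le v a.1 _)))
  have hcsum : ((∑ a, c a : NNReal) : ℝ) = n * (2 / 3) ^ k := by
    have hca : ∀ a, (c a : ℝ) = weightBound v a.1 := fun a => by
      simp only [hc, NNReal.coe_pow, NNReal.coe_div, coe_nnnorm, sub_neg_eq_add, ← two_mul,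
        Real.norm_eq_abs, abs_mul, abs_of_nonneg (Real.sqrt_nonneg _)]
      simp [Real.sq_sqrt (weightBound_nonneg v a.1)]
    push_cast
    simp only [hca, Fintype.sum_prod_type, Finset.sum_const, Finset.card_univ, Fintype.card_fin,
      nsmul_eq_mul, ← Finset.mul_sum, sum_weightBound hv]
  have hS := HasSubgaussianMGF.sum_of_iIndepFun hindep hsub
  have hexp : -(n * t) ^ 2 / (2 * ((∑ a, c a : NNReal) : ℝ)) =
      -(n * t ^ 2) / (2 * (2 / 3) ^ k) := by
    rw [hcsum]; field_simp
  have h1 := hS.measure_ge_le (mul_nonneg hn'.le ht)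
  have h2 := hS.neg.measure_ge_le (mul_nonneg hn'.le ht)
  rw [hexp] at h1 h2
  calc _ ≤ μ.real ({ω | n * t ≤ ∑ a, Y a ω} ∪ {ω | n * t ≤ (-fun ω => ∑ a, Y a ω) ω}) := by
        refine measureReal_mono fun ω hω => ?_
        simp only [Set.mem_union, Set.mem_ofPred_eq, Pi.neg_apply, hsum] at hω ⊢
        rw [← mul_neg, mul_le_mul_iff_right₀ hn', mul_le_mul_iff_right₀ hn']
        exact le_abs.mp hω
    _ ≤ _ := measureReal_union_le _ _
    _ ≤ _ := by rw [two_mul]; exact add_le_add h1 h2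

end Tomography

/-! ### From a finite net to the operator norm -/

/-- On a finite-dimensional inner product space, the norm of a symmetric operator is controlled
by its quadratic form on a fixed finite set of unit vectors. -/
theorem exists_finset_norm_le_of_abs_inner_le (E : Type*) [NormedAddCommGroup E]
    [InnerProductSpace ℂ E] [FiniteDimensional ℂ E] :
    ∃ S : Finset E, (∀ w ∈ S, ‖w‖ = 1) ∧ ∀ T : E →L[ℂ] E, T.IsSymmetric → ∀ c : ℝ, 0 ≤ c →
      (∀ w ∈ S, |(inner ℂ (T w) w).re| ≤ 3 / 4 * c) → ‖T‖ ≤ c := by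
  have : ProperSpace E := FiniteDimensional.proper ℂ E
  -- Moving to the nearest net point changes the quadratic form by at most `2 · (1/8) ‖T‖`; this
  -- quarter of `‖T‖` is absorbed on the left at the end.
  obtain ⟨S, hS, hfin, hcov⟩ := (isCompact_sphere (0 : E) 1).finite_cover_balls
    (e := 1 / 8) (by norm_num)
  refine ⟨hfin.toFinset, fun w hw => by simpa using hS (hfin.mem_toFinset.mp hw), ?_⟩
  intro T hT c hc h
  have hquad : ∀ x : E, ‖x‖ = 1 → |(inner ℂ (T x) x).re| ≤ 3 / 4 * c + 1 / 4 * ‖T‖ := by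
    intro x hx
    obtain ⟨w, hw, hxw⟩ := Set.mem_iUnion₂.mp (hcov (mem_sphere_zero_iff_norm.mpr hx))
    have hd : ‖x - w‖ ≤ 1 / 8 := (mem_ball_iff_norm.mp hxw).le
    have hw1 : ‖w‖ = 1 := by simpa using hS hw
    have hdec : inner ℂ (T x) x =
        inner ℂ (T w) w + (inner ℂ (T (x - w)) x + inner ℂ (T w) (x - w)) := by
      rw [map_sub, inner_sub_left, inner_sub_right]; ring
    have h1 : |(inner ℂ (T (x - w)) x).re| ≤ ‖T‖ * (1 / 8) := by
      refine (Complex.abs_re_le_norm _).trans ((norm_inner_le_norm _ _).trans ?_)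
      rw [hx, mul_one]
      exact (T.le_opNorm _).trans (by gcongr)
    have h2 : |(inner ℂ (T w) (x - w)).re| ≤ ‖T‖ * (1 / 8) := by
      refine (Complex.abs_re_le_norm _).trans ((norm_inner_le_norm _ _).trans ?_)
      have := T.le_opNorm w
      rw [hw1, mul_one] at this
      gcongr
    have h3 := h w (hfin.mem_toFinset.mpr hw)
    rw [hdec, Complex.add_re, Complex.add_re]
    rw [abs_le] at h1 h2 h3 ⊢
    constructor <;> linarith [h1.1, h1.2, h2.1, h2.2, h3.1, h3.2]
  have hle : ‖T‖ ≤ 3 / 4 * c + 1 / 4 * ‖T‖ := by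
    -- Symmetry makes the norm the supremum of the absolute Rayleigh quotients, which scaling
    -- reduces to unit vectors.
    conv_lhs => rw [T.norm_eq_iSup_rayleighQuotient hT]
    refine ciSup_le fun x => ?_
    rcases eq_or_ne x 0 with rfl | hx
    · rw [ContinuousLinearMap.rayleighQuotient_apply_zero, abs_zero]; positivity
    · have hx' : ((‖x‖⁻¹ : ℝ) : ℂ) ≠ 0 := by simpa using hx
      rw [← T.rayleigh_smul x hx']
      have h1 : ‖((‖x‖⁻¹ : ℝ) : ℂ) • x‖ = 1 := by simp [norm_smul, hx]
      rw [ContinuousLinearMap.rayleighQuotient, h1, one_pow, div_one]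
      exact hquad _ h1
  linarith

namespace Tomography

/-! ### The operator norm bound -/

theorem re_inner_toEuclideanCLM {k : ℕ} (M : Mat k) (w : EuclideanSpace ℂ (Fin k → Fin 2)) :
    (inner ℂ (Matrix.toEuclideanCLM (n := Fin k → Fin 2) (𝕜 := ℂ) M w) w).re =
      (expect w.ofLp M).re := by
  rw [expect, Matrix.vecMulVec_mul, Matrix.trace_vecMulVec, ← inner_conj_symm,
    EuclideanSpace.inner_eq_star_dotProduct, Matrix.ofLp_toEuclideanCLM, Complex.conj_re,
    dotProduct_comm w.ofLp, ← Matrix.dotProduct_mulVec, dotProduct_comm]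

theorem star_dotProduct_of_norm_eq_one {k : ℕ} {w : EuclideanSpace ℂ (Fin k → Fin 2)}
    (hw : ‖w‖ = 1) : star w.ofLp ⬝ᵥ w.ofLp = 1 := by
  rw [dotProduct_comm, ← EuclideanSpace.inner_eq_star_dotProduct, inner_self_eq_norm_sq_to_K, hw]
  simp

theorem trace_pauliString {k : ℕ} (b : PauliLabel k) :
    (pauliString b).trace = if b = fun _ => none then 2 ^ k else 0 := by
  have h : ∀ β : Option Axis, (pauliExt β).trace = if β = none then 2 else 0 := by
    rintro (_ | _ | _ | _) <;> simp [pauliExt, pauli, Matrix.trace_fin_two]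
  rw [pauliString, trace_tensor]
  simp only [h]
  split_ifs with hb
  · simp [hb]
  · obtain ⟨j, hj⟩ := Function.ne_iff.mp hb
    exact Finset.prod_eq_zero (Finset.mem_univ j) (if_neg hj)

/-- Only the identity string has nonzero trace, so the trace is the total mass of `f` averaged over
the `3^k` settings. -/
theorem trace_lse {k : ℕ} (f : Setting k → Outcome k → ℝ) :
    (lse f).trace = ((∑ s, ∑ o, f s o : ℝ) : ℂ) / 3 ^ k := by
  have h : ∀ (s : Setting k) (o : Outcome k), realCoeff (fun _ => none) s o = 1 := fun s o =>
    Finset.prod_eq_one fun _ _ => rfl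
  simp only [lse, Matrix.trace_sum, Matrix.trace_smul, trace_pauliString, smul_eq_mul, mul_ite,
    mul_zero, Finset.sum_ite_eq', Finset.mem_univ, if_true, lsCoeff_eq, h, mul_one, numId,
    Finset.filter_true, Finset.card_univ, Fintype.card_fin]
  field_simp

theorem trace_lse_freq {k n : ℕ} (hn : 1 ≤ n) (x : Setting k × Fin n → Outcome k) :
    (lse (freq x)).trace = 1 := by
  have hn' : (n : ℝ) ≠ 0 := by exact_mod_cast (by omega : n ≠ 0)
  have h : ∀ s, ∑ o, freq x s o = 1 := fun s => by
    have := sum_freq_mul x s fun _ => 1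
    simpa [hn'] using this
  have hcard : Fintype.card Axis = 3 := rfl
  rw [trace_lse]
  simp [h, hcard]

theorem eq_lse_of_isTraceOneProjection {k n : ℕ} (hn : 1 ≤ n) {x : Setting k × Fin n → Outcome k}
    {τ : Mat k} (h : IsTraceOneProjection (lse (freq x)) τ) : τ = lse (freq x) := by
  simpa [trace_lse_freq hn] using (isTraceOneProjection_iff (lse_isHermitian _) τ).mp h

theorem exists_forall_lt_measure_opNorm_le (k : ℕ) :
    ∃ ε₀ : ℝ, 0 < ε₀ ∧ ∀ ε : ℝ, 0 < ε → ε ≤ ε₀ →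
      ∀ n : ℕ, 1 ≤ n → ∀ ρ : Mat k, IsDensity ρ →
      ∀ (Ω : Type*) [MeasurableSpace Ω] (μ : Measure Ω) [IsProbabilityMeasure μ]
        (X : Setting k × Fin n → Ω → Outcome k), IsSample ρ μ X →
        1 - ε < μ.real {ω | opNorm (lse (freq fun a => X a ω) - ρ) ≤ 2 * nu k n ε} := by
  obtain ⟨S, hS1, hS⟩ :=
    exists_finset_norm_le_of_abs_inner_le (EuclideanSpace ℂ (Fin k → Fin 2))
  -- Chosen so that `2 |S| ε < 1`, which makes the union bound `|S| · 2ε²` smaller than `ε`.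
  refine ⟨1 / (2 * S.card + 1), by positivity, fun ε hε hεS n hn ρ hρ Ω _ μ _ X hX => ?_⟩
  have hn' : (0 : ℝ) < n := by exact_mod_cast hn
  have hSε : 2 * S.card * ε < 1 := by
    rw [le_div_iff₀ (by positivity)] at hεS
    linarith
  have hε1 : ε ≤ 1 := hεS.trans (div_le_one_of_le₀ (by simp) (by positivity))
  set ℓ := Real.log (2 ^ (k + 1) / ε) with hℓ
  have hℓ0 : -ℓ ≤ Real.log ε := by
    rw [hℓ, Real.log_div (by positivity) hε.ne', neg_sub]
    exact sub_le_self _ (Real.log_nonneg (one_le_pow₀ (by norm_num)))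
  have hℓ1 : 0 ≤ ℓ := by linarith [Real.log_nonpos hε.le hε1]
  have hν : nu k n ε ^ 2 = 2 / n * (2 / 3) ^ k * ℓ := Real.sq_sqrt (by positivity)
  -- The threshold on the net for norm `2ν`. It gives the exponent `-(9/4) ℓ`; as `ℓ ≥ 0` and `ℓ ≥
  -- -log ε`, this is at most `2 log ε`.
  set t := 3 / 4 * (2 * nu k n ε) with ht
  have ht0 : 0 ≤ t := by have : 0 ≤ nu k n ε := Real.sqrt_nonneg _; positivity
  have hexp : Real.exp (-(n * t ^ 2) / (2 * (2 / 3) ^ k)) ≤ ε ^ 2 := by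
    have h1 : -(n * t ^ 2) / (2 * (2 / 3) ^ k) = -(9 / 4 * ℓ) := by
      have h2 : t ^ 2 = 9 / 4 * nu k n ε ^ 2 := by rw [ht]; ring
      rw [h2, hν]
      field_simp
    have h2 : ε ^ 2 = Real.exp (2 * Real.log ε) := by
      rw [two_mul, Real.exp_add, Real.exp_log hε, pow_two]
    rw [h1, h2, Real.exp_le_exp]
    linarith
  set Z : Ω → Mat k := fun ω => lse (freq fun a => X a ω) - ρ with hZ
  set good : Set Ω := {ω | opNorm (Z ω) ≤ 2 * nu k n ε} with hgood
  have hbad : goodᶜ ⊆ ⋃ w ∈ S, {ω | t ≤ |(expect w.ofLp (Z ω)).re|} := by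
    intro ω hω
    by_contra hc
    simp only [Set.mem_iUnion, Set.mem_ofPred_eq, not_exists, not_le] at hc
    have h0 : 0 ≤ 2 * nu k n ε := mul_nonneg zero_le_two (Real.sqrt_nonneg _)
    refine hω (hS _ ?_ _ h0 fun w hw => ?_)
    · exact Matrix.isSymmetric_toEuclideanLin_iff.mpr
        ((lse_isHermitian _).sub hρ.1.isHermitian)
    · rw [re_inner_toEuclideanCLM]
      exact (hc w hw).le
  have hbad' : μ.real goodᶜ < ε :=
    calc μ.real goodᶜ ≤ μ.real (⋃ w ∈ S, {ω | t ≤ |(expect w.ofLp (Z ω)).re|}) :=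
          measureReal_mono hbad (measure_ne_top _ _)
      _ ≤ ∑ w ∈ S, μ.real {ω | t ≤ |(expect w.ofLp (Z ω)).re|} :=
          measureReal_biUnion_finset_le _ _
      _ ≤ ∑ w ∈ S, 2 * ε ^ 2 := Finset.sum_le_sum fun w hw =>
          (hX.measure_expect_ge_le hn hρ.1 (star_dotProduct_of_norm_eq_one (hS1 w hw)) ht0).trans
            (by gcongr)
      _ = 2 * S.card * ε * ε := by rw [Finset.sum_const, nsmul_eq_mul]; ring
      _ < 1 * ε := by gcongr
      _ = ε := one_mul ε
  -- Subadditivity suffices, so measurability of `good` is not needed.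
  have huniv : (1 : ℝ) ≤ μ.real good + μ.real goodᶜ := by
    have := measureReal_union_le (μ := μ) good goodᶜ
    rwa [Set.union_compl_self, probReal_univ] at this
  linarith

end Tomography

theorem proposition2 (k : ℕ) :
    (∀ f : Tomography.Setting k → Tomography.Outcome k → ℝ,
      (∀ θ : Tomography.PauliLabel k → ℂ, θ ≠ Tomography.lsCoeff f →
        Tomography.lsCriterion f (Tomography.lsCoeff f) < Tomography.lsCriterion f θ) ∧
      ∃ hM : (Tomography.lse f).IsHermitian,
        (∃! τ : Tomography.Mat k, Tomography.IsTraceOneProjection (Tomography.lse f) τ) ∧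
        ∀ τ : Tomography.Mat k, Tomography.IsTraceOneProjection (Tomography.lse f) τ →
          ∃ (hτ : τ.IsHermitian) (c : ℝ),
            c = (1 - ∑ j, hM.eigenvalues₀ j) / 2 ^ k ∧
            (∀ j, hτ.eigenvalues₀ j = hM.eigenvalues₀ j + c) ∧
            ∀ (v : (Fin k → Fin 2) → ℂ) (a : ℂ),
              Tomography.lse f *ᵥ v = a • v ↔ τ *ᵥ v = (a + (c : ℂ)) • v) ∧
    ∃ ε₀ : ℝ, 0 < ε₀ ∧ ∀ ε : ℝ, 0 < ε → ε ≤ ε₀ →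
      ∀ n : ℕ, 1 ≤ n → ∀ ρ : Tomography.Mat k, Tomography.IsDensity ρ →
      ∀ (Ω : Type*) [MeasurableSpace Ω] (μ : Measure Ω) [IsProbabilityMeasure μ]
        (X : Tomography.Setting k × Fin n → Ω → Tomography.Outcome k),
        Tomography.IsSample ρ μ X →
        ∀ τ : Ω → Tomography.Mat k,
          (∀ ω, Tomography.IsTraceOneProjection
            (Tomography.lse (Tomography.freq fun a => X a ω)) (τ ω)) →
          1 - ε < μ.real {ω | Tomography.opNorm (τ ω - ρ) ≤ 2 * Tomography.nu k n ε} := by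

  open Tomography in
  refine ⟨fun f => ⟨fun θ hθ => lsCriterion_lsCoeff_lt f hθ, lse_isHermitian f, ?_, ?_⟩, ?_⟩
  · simp only [isTraceOneProjection_iff (lse_isHermitian f)]
    exact existsUnique_eq
  · intro τ hτ
    have h := (isTraceOneProjection_iff (lse_isHermitian f) τ).mp hτ
    refine ⟨hτ.1.1, _, rfl, ?_⟩
    rw [sum_eigenvalues₀]
    refine ⟨eigenvalues₀_add_smul_one _ _ h, fun v a => ?_⟩
    rw [h, Matrix.add_mulVec, add_smul, Matrix.smul_mulVec, Matrix.one_mulVec, add_left_inj]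
  · obtain ⟨ε₀, hε₀, h⟩ := exists_forall_lt_measure_opNorm_le k
    refine ⟨ε₀, hε₀, fun ε hε hle n hn ρ hρ Ω _ μ _ X hX τ hτ => ?_⟩
    simp only [eq_lse_of_isTraceOneProjection hn (hτ _)]
    exact h ε hε hle n hn ρ hρ Ω μ X hX
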